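/- Let $p,q,n$ be positive integers with $p<q\le n/2$. Let $\alpha,\beta,x_0,\dots,x_{n-1}$ be independent indeterminates, and let $y_0,y_1,\dots$ be the sequence in the field of rational functions $\mathbb{Q}(\alpha,\beta,x_0,\dots,x_{n-1})$ with $y_i=x_i$ for $0\le i<n$ and $$y_{k+n}=\frac{\alpha\, y_{k+p}\,y_{k+n-p}+\beta\, y_{k+q}\,y_{k+n-q}}{y_k}\qquad (k\ge 0).$$ Then for every $m\ge 0$ the term $y_m$ is nonzero (so that all the divisions make sense), and $y_m$ is a Laurent polynomial in the initial terms $y_0,\dots,y_{n-1}$ with coefficients in $\mathbb{Z}[\alpha,\beta]$: there is $L_m\in\mathbb{Z}[\alpha,\beta][x_0^{\pm1},\dots,x_{n-1}^{\pm1}]$ with $y_m=L_m(\alpha,\beta;x_0,\dots,x_{n-1})$. Moreover, the same $L_m$ expresses the $m$-th term as a function of the initial terms for every choice of the parameters: if $K$ is a field, $a,b\in K$, and $z_0,z_1,\dots$ is a sequence of nonzero elements of $K$ satisfying the recurrence with $\alpha=a$, $\beta=b$, then $z_m=L_m(a,b;z_0,\dots,z_{n-1})$. In particular, taking $a=b=1$,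 $p=1$, $q=2$ and $n=4$ (resp. $n=5$), this covers the Somos-4 (resp. Somos-5) recurrence. -/

import Mathlib

universe u

/-- The Laurent polynomial ring `R[x_0^{±1}, …, x_{n-1}^{±1}]`: finitely supported `R`-linear
combinations of monomials `x^e`, one for each exponent vector `e : Fin n → ℤ`. -/
abbrev LaurentPoly (R : Type*) [CommRing R] (n : ℕ) : Type _ := AddMonoidAlgebra R (Fin n → ℤ)

/-- The value of a Laurent polynomial with coefficients in `ℤ[α, β]` (the polynomial ring in the
two variables `α = X 0` and `β = X 1`) at `α = a`, `β = b`, `x_i = x i`, in a field `K`.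
It is meaningful when all `x i` are nonzero. -/
noncomputable def LaurentPoly.value {n : ℕ} (L : LaurentPoly (MvPolynomial (Fin 2) ℤ) n)
    {K : Type*} [Field K] (a b : K) (x : Fin n → K) : K :=
  ∑ e ∈ L.coeff.support, MvPolynomial.aeval ![a, b] (L.coeff e) * ∏ i, x i ^ e i

/-- The field `ℚ(α, β, x_0, …, x_{n-1})` of rational functions, as the fraction field of
`ℤ[α, β, x_0, …, x_{n-1}]`. -/
abbrev RatFunField (n : ℕ) : Type := FractionRing (MvPolynomial (Fin 2 ⊕ Fin n) ℤ)

/-- The indeterminate `α`. -/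
noncomputable def RatFunField.α (n : ℕ) : RatFunField n :=
  algebraMap (MvPolynomial (Fin 2 ⊕ Fin n) ℤ) (RatFunField n) (MvPolynomial.X (Sum.inl 0))

/-- The indeterminate `β`. -/
noncomputable def RatFunField.β (n : ℕ) : RatFunField n :=
  algebraMap (MvPolynomial (Fin 2 ⊕ Fin n) ℤ) (RatFunField n) (MvPolynomial.X (Sum.inl 1))

/-- The indeterminate `x_i`. -/
noncomputable def RatFunField.x {n : ℕ} (i : Fin n) : RatFunField n :=
  algebraMap (MvPolynomial (Fin 2 ⊕ Fin n) ℤ) (RatFunField n) (MvPolynomial.X (Sum.inr i))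

/-- The sequence `y_0, y_1, …` in the field `K` satisfies the two-term Gale-Robinson recurrence
`y_{k+n} = (a y_{k+p} y_{k+n-p} + b y_{k+q} y_{k+n-q}) / y_k` for all `k ≥ 0`
(to be used with `p, q ≤ n` and, for the division, with `y_k ≠ 0`). -/
def IsTwoTermGaleRobinson {K : Type*} [Field K] (n p q : ℕ) (a b : K) (y : ℕ → K) : Prop :=
  ∀ k : ℕ, y (k + n) =
    (a * y (k + p) * y (k + n - p) + b * y (k + q) * y (k + n - q)) / y k

/-! Let Λ be the Laurent ring, a domain whose units include the initial terms. That every `y m` lies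
in Λ is proved by strong induction. Below 2n the division is by a unit. At 2n the numerator is
divisible by `y n` (`numerator_mul_eq`). For m > 2n, apply the induction hypothesis to shifted
sequences. From the window 1, …, n, `y m` has only powers of `y n` as denominators; from the window
n+1, …, 2n, only products of those n terms. Since `y n` is prime (`prime_param_mul_mon_add`) and
divides no term of the second window, `y m` is in Λ
(`exists_algebraMap_eq_of_mem_denominatorSubring`). The non-divisibility is seen at α = 1, β = 2,
x_p = -2, other x_i = 1: there `y n` vanishes, while parity keeps the next n terms nonzero
(`apply_ne_zero`, `cofactor_ne_zero`). The resulting identities in Λ specialize to every field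
(`apply_eq_value`). -/

/-- The sequence `y` in the commutative ring `R` satisfies, in division-free form, those instances
of the Gale-Robinson recurrence that involve only terms of index less than `m`. -/
def SatisfiesGaleRobinsonBelow {R : Type*} [CommRing R] (n p q m : ℕ) (a b : R) (y : ℕ → R) :
    Prop :=
  ∀ k, k + n < m →
    y (k + n) * y k = a * y (k + p) * y (k + n - p) + b * y (k + q) * y (k + n - q)

/-! ### Division-free recurrence and the numerator of `y (2 * n)`. -/

namespace SatisfiesGaleRobinsonBelow

variable {R S : Type*} [CommRing R] [CommRing S] {n p q m : ℕ} {a b : R} {y : ℕ → R}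

theorem map (h : SatisfiesGaleRobinsonBelow n p q m a b y) (f : R →+* S) :
    SatisfiesGaleRobinsonBelow n p q m (f a) (f b) (fun k => f (y k)) := by
  intro k hk
  simpa only [map_mul, map_add] using congrArg f (h k hk)

theorem rel (h : SatisfiesGaleRobinsonBelow n p q m a b y) (k : ℕ) {l i j i' j' : ℕ}
    (hm : k + n < m) (hl : k + n = l) (hi : k + p = i) (hj : k + n - p = j) (hi' : k + q = i')
    (hj' : k + n - q = j') : y l * y k = a * y i * y j + b * y i' * y j' := by
  subst hl hi hj hi' hj'
  exact h k hm

/-- The cofactor of `y_n` in the numerator of `y_{2n}`, up to the factor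
`y_p y_{n-p} y_q y_{n-q}`. -/
def cofactor (n p q : ℕ) (a b : R) (y : ℕ → R) : R :=
  a * (y q * y (n - q)) * (a ^ 2 * y (2 * p) * y (2 * n - 2 * p) * y n +
      a * b * (y (2 * p) * (y (n + q - p) * y (2 * n - p - q)) +
        y (2 * n - 2 * p) * (y (p + q) * y (n + p - q)))) +
    b * (y p * y (n - p)) * (b ^ 2 * y (2 * q) * y (2 * n - 2 * q) * y n +
      a * b * (y (2 * q) * (y (n + p - q) * y (2 * n - p - q)) +
        y (2 * n - 2 * q) * (y (p + q) * y (n + q - p)))) +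
    a * b * y 0 * (y (p + q) * y (n + p - q) * y (n + q - p) * y (2 * n - p - q))

/-- Expand each of the four outer terms by its own recurrence. The only products without a visible
factor `y n` combine to a b (a y_p y_{n-p} + b y_q y_{n-q}) times a common product, and the bracket
is y_n y_0. -/
theorem numerator_mul_eq (h : SatisfiesGaleRobinsonBelow n p q m a b y) (hm : 2 * n ≤ m)
    (hp : 0 < p) (hpq : p < q) (hqn : 2 * q ≤ n) :
    (a * y (n + p) * y (2 * n - p) + b * y (n + q) * y (2 * n - q)) *
      (y p * y (n - p) * (y q * y (n - q))) = y n * cofactor n p q a b y := by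
  have h0 : y n * y 0 = a * y p * y (n - p) + b * y q * y (n - q) := by
    apply h.rel <;> omega
  have h1 : y (n + p) * y p = a * y (2 * p) * y n + b * y (p + q) * y (n + p - q) := by
    apply h.rel <;> omega
  have h2 : y (2 * n - p) * y (n - p) =
      a * y n * y (2 * n - 2 * p) + b * y (n + q - p) * y (2 * n - p - q) := by
    apply h.rel <;> omega
  have h3 : y (n + q) * y q = a * y (p + q) * y (n + q - p) + b * y (2 * q) * y n := by
    apply h.rel <;> omega
  have h4 : y (2 * n - q) * y (n - q) =
      a * y (n + p - q) * y (2 * n - p - q) + b * y n * y (2 * n - 2 * q) := by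
    apply h.rel <;> omega
  rw [cofactor]
  linear_combination
    a * (y q * y (n - q)) * (h1 * (y (2 * n - p) * y (n - p)) +
      (a * y (2 * p) * y n + b * y (p + q) * y (n + p - q)) * h2) +
    b * (y p * y (n - p)) * (h3 * (y (2 * n - q) * y (n - q)) +
      (a * y (p + q) * y (n + q - p) + b * y (2 * q) * y n) * h4) -
    a * b * (y (p + q) * y (n + p - q) * y (n + q - p) * y (2 * n - p - q)) * h0

/-! ### Parity at the specialization where `y n` vanishes. -/

section Parity

variable {v : ℕ → ℚ}

/-- The rational number `r` is an odd integer. -/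
def IsOddInt (r : ℚ) : Prop := ∃ c : ℤ, Odd c ∧ r = c

theorem IsOddInt.mul {r s : ℚ} (hr : IsOddInt r) (hs : IsOddInt s) : IsOddInt (r * s) := by
  obtain ⟨c, hc, rfl⟩ := hr
  obtain ⟨d, hd, rfl⟩ := hs
  exact ⟨c * d, hc.mul hd, by push_cast; rfl⟩

theorem IsOddInt.ne_zero {r : ℚ} (hr : IsOddInt r) : r ≠ 0 := by
  obtain ⟨c, hc, rfl⟩ := hr
  intro h
  have : c = 0 := by exact_mod_cast h
  subst this
  simp at hc

theorem apply_n_eq_zero (h : SatisfiesGaleRobinsonBelow n p q m 1 2 v) (hm : n < m)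
    (hp : 0 < p) (hpq : p < q) (hqn : 2 * q ≤ n)
    (hv : ∀ i < n, v i = if i = p then -2 else 1) : v n = 0 := by
  have h0 : v n * v 0 = 1 * v p * v (n - p) + 2 * v q * v (n - q) := by
    apply h.rel <;> omega
  rw [hv 0 (by omega), hv p (by omega), hv (n - p) (by omega), hv q (by omega),
    hv (n - q) (by omega), if_neg (by omega), if_pos rfl, if_neg (by omega), if_neg (by omega),
    if_neg (by omega)] at h0
  linarith

/-- Since b = 2, the parity of a new term is that of its first product, whose factors avoid the
three exceptional indices. The only divisor other than 1 is v_p = -2. -/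
theorem isOddInt_apply (h : SatisfiesGaleRobinsonBelow n p q m 1 2 v) (hm : 2 * n ≤ m)
    (hp : 0 < p) (hpq : p < q) (hqn : 2 * q ≤ n)
    (hv : ∀ i < n, v i = if i = p then -2 else 1) (i : ℕ) (hi : i < 2 * n) :
    (i ≠ p → i ≠ n → i ≠ 2 * n - p → IsOddInt (v i)) ∧ ∃ c : ℤ, v i = c := by
  have hvn := h.apply_n_eq_zero (by omega) hp hpq hqn hv
  induction i using Nat.strong_induction_on with
  | _ i ih =>
    rcases lt_trichotomy i n with hin | rfl | hin
    · rw [hv i hin]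
      split_ifs with hip
      · exact ⟨fun hne => absurd hip hne, -2, by norm_num⟩
      · exact ⟨fun _ _ _ => ⟨1, odd_one, by norm_num⟩, 1, by norm_num⟩
    · exact ⟨fun _ hne => absurd rfl hne, 0, by simpa using hvn⟩
    · obtain ⟨j, rfl⟩ : ∃ j, i = j + n := ⟨i - n, by omega⟩
      have hr := h j (by omega)
      -- Here v_n = 0 kills the first product, and the 2 in β cancels against the divisor -2.
      by_cases hjp : j = p
      · subst hjp
        have e : j + n - j = n := by omega
        rw [hv j (by omega), if_pos rfl, e, hvn] at hr
        have hodd : IsOddInt (v (j + n)) := by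
          obtain ⟨c, hc, hc'⟩ := ((ih (j + q) (by omega) (by omega)).1
            (by omega) (by omega) (by omega)).mul
            ((ih (j + n - q) (by omega) (by omega)).1 (by omega) (by omega) (by omega))
          refine ⟨-c, hc.neg, ?_⟩
          push_cast
          linarith
        exact ⟨fun _ _ _ => hodd, hodd.imp fun c hc => hc.2⟩
      rw [hv j (by omega), if_neg hjp] at hr
      obtain ⟨a₁, h₁⟩ := (ih (j + p) (by omega) (by omega)).2
      obtain ⟨a₂, h₂⟩ := (ih (j + n - p) (by omega) (by omega)).2
      obtain ⟨a₃, h₃⟩ := (ih (j + q) (by omega) (by omega)).2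
      obtain ⟨a₄, h₄⟩ := (ih (j + n - q) (by omega) (by omega)).2
      have hint : v (j + n) = ((a₁ * a₂ + 2 * (a₃ * a₄) : ℤ) : ℚ) := by
        push_cast
        rw [h₁, h₂, h₃, h₄] at hr
        linarith
      refine ⟨fun _ _ hne => ⟨_, ?_, hint⟩, _, hint⟩
      obtain ⟨c, hc, hc'⟩ := ((ih (j + p) (by omega) (by omega)).1
            (by omega) (by omega) (by omega)).mul
            ((ih (j + n - p) (by omega) (by omega)).1 (by omega) (by omega) (by omega))
      have : a₁ * a₂ = c := by
        rw [h₁, h₂] at hc'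
        exact_mod_cast hc'
      rw [this]
      exact hc.add_even (even_two_mul _)

theorem apply_ne_zero (h : SatisfiesGaleRobinsonBelow n p q m 1 2 v) (hm : 2 * n ≤ m)
    (hp : 0 < p) (hpq : p < q) (hqn : 2 * q ≤ n)
    (hv : ∀ i < n, v i = if i = p then -2 else 1) (i : ℕ) (hni : n < i) (hi : i < 2 * n) :
    v i ≠ 0 := by
  have hodd := h.isOddInt_apply hm hp hpq hqn hv
  -- This even term is twice a product of two odd integers, because v_n = 0.
  by_cases hip : i = 2 * n - p
  · have h2 : v (2 * n - p) * v (n - p) =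
        1 * v n * v (2 * n - 2 * p) + 2 * v (n + q - p) * v (2 * n - p - q) := by
      apply h.rel <;> omega
    rw [h.apply_n_eq_zero (by omega) hp hpq hqn hv] at h2
    have h3 := (((hodd (n + q - p) (by omega)).1 (by omega) (by omega) (by omega)).mul
      ((hodd (2 * n - p - q) (by omega)).1 (by omega) (by omega) (by omega))).ne_zero
    intro h0
    rw [hip] at h0
    rw [h0] at h2
    apply h3
    linarith
  · exact ((hodd i hi).1 (by omega) (by omega) hip).ne_zero

theorem cofactor_ne_zero (h : SatisfiesGaleRobinsonBelow n p q m 1 2 v) (hm : 2 * n ≤ m)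
    (hp : 0 < p) (hpq : p < q) (hqn : 2 * q ≤ n)
    (hv : ∀ i < n, v i = if i = p then -2 else 1) : cofactor n p q 1 2 v ≠ 0 := by
  have hodd := h.isOddInt_apply hm hp hpq hqn hv
  have odd_of {i : ℕ} (hi : i < 2 * n) (h₁ : i ≠ p) (h₂ : i ≠ n) (h₃ : i ≠ 2 * n - p) :=
    (hodd i hi).1 h₁ h₂ h₃
  obtain ⟨c₁, o₁, e₁⟩ := odd_of (i := 2 * p) (by omega) (by omega) (by omega) (by omega)
  obtain ⟨c₂, o₂, e₂⟩ := odd_of (i := 2 * n - 2 * p) (by omega) (by omega) (by omega) (by omega)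
  obtain ⟨c₃, o₃, e₃⟩ := odd_of (i := n + q - p) (by omega) (by omega) (by omega) (by omega)
  obtain ⟨c₄, o₄, e₄⟩ := odd_of (i := 2 * n - p - q) (by omega) (by omega) (by omega) (by omega)
  obtain ⟨c₅, o₅, e₅⟩ := odd_of (i := p + q) (by omega) (by omega) (by omega) (by omega)
  obtain ⟨c₆, o₆, e₆⟩ := odd_of (i := n + p - q) (by omega) (by omega) (by omega) (by omega)
  -- Only integrality is available for these two: 2q = n is allowed, and v_n = 0.
  obtain ⟨d₁, f₁⟩ := (hodd (2 * q) (by omega)).2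
  obtain ⟨d₂, f₂⟩ := (hodd (2 * n - 2 * q) (by omega)).2
  rw [cofactor, h.apply_n_eq_zero (by omega) hp hpq hqn hv, e₁, e₂, e₃, e₄, e₅, e₆, f₁, f₂,
    hv 0 (by omega), hv p (by omega), hv (n - p) (by omega), hv q (by omega),
    hv (n - q) (by omega), if_neg (by omega), if_pos rfl, if_neg (by omega), if_neg (by omega),
    if_neg (by omega)]
  intro h0
  -- Half the cofactor: three odd products plus a multiple of 4, hence odd.
  have h1 : (c₁ * (c₃ * c₄) + c₂ * (c₅ * c₆)) - 4 * (d₁ * (c₆ * c₄) + d₂ * (c₅ * c₃)) +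
      c₅ * c₆ * c₃ * c₄ = 0 := by
    have : (((c₁ * (c₃ * c₄) + c₂ * (c₅ * c₆)) - 4 * (d₁ * (c₆ * c₄) + d₂ * (c₅ * c₃)) +
      c₅ * c₆ * c₃ * c₄ : ℤ) : ℚ) = 0 := by
      push_cast
      linarith
    exact_mod_cast this
  have h2 : Odd ((c₁ * (c₃ * c₄) + c₂ * (c₅ * c₆)) - 4 * (d₁ * (c₆ * c₄) + d₂ * (c₅ * c₃)) +
      c₅ * c₆ * c₃ * c₄) := by
    refine Even.add_odd (Even.sub ((o₁.mul (o₃.mul o₄)).add_odd (o₂.mul (o₅.mul o₆))) ?_)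
      (((o₅.mul o₆).mul o₃).mul o₄)
    exact (by decide : Even (4 : ℤ)).mul_right _
  rw [h1] at h2
  simp at h2

end Parity

end SatisfiesGaleRobinsonBelow

/-! ### The Laurent ring: evaluation, units and a prime element. -/

namespace LaurentPoly

open MvPolynomial

variable {n : ℕ}

/-- The ring homomorphism from `ℤ[α, β][x_0^{±1}, …, x_{n-1}^{±1}]` that sends `α` to `a`, `β` to
`b` and each Laurent monomial to its image under `g`. -/
noncomputable def evalMonomial {S : Type*} [CommRing S] (a b : S)
    (g : Multiplicative (Fin n → ℤ) →* S) : LaurentPoly (MvPolynomial (Fin 2) ℤ) n →+* S :=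
  AddMonoidAlgebra.liftNCRingHom (aeval ![a, b] : MvPolynomial (Fin 2) ℤ →ₐ[ℤ] S).toRingHom g
    (fun _ _ => Commute.all _ _)

theorem evalMonomial_single {S : Type*} [CommRing S] (a b : S)
    (g : Multiplicative (Fin n → ℤ) →* S) (e : Fin n → ℤ) (r : MvPolynomial (Fin 2) ℤ) :
    evalMonomial a b g (AddMonoidAlgebra.single e r) =
      aeval ![a, b] r * g (Multiplicative.ofAdd e) :=
  AddMonoidAlgebra.liftNC_single _ _ _ _

/-- The Laurent monomial `x^e`. -/
noncomputable def mon (e : Fin n → ℤ) : LaurentPoly (MvPolynomial (Fin 2) ℤ) n :=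
  AddMonoidAlgebra.single e 1

/-- The constant Laurent polynomial `α` (for `i = 0`) or `β` (for `i = 1`). -/
noncomputable def param (n : ℕ) (i : Fin 2) : LaurentPoly (MvPolynomial (Fin 2) ℤ) n :=
  AddMonoidAlgebra.single 0 (MvPolynomial.X i)

/-- The variable `x_i` as a Laurent polynomial (equal to `1` if `n ≤ i`). -/
noncomputable def var (n i : ℕ) : LaurentPoly (MvPolynomial (Fin 2) ℤ) n :=
  mon fun j => if (j : ℕ) = i then 1 else 0

theorem mon_mul_mon (e f : Fin n → ℤ) : mon e * mon f = mon (e + f) := by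
  simp [mon, AddMonoidAlgebra.single_mul_single]

theorem mon_zero : mon (0 : Fin n → ℤ) = 1 := rfl

theorem isUnit_mon (e : Fin n → ℤ) : IsUnit (mon e) :=
  IsUnit.of_mul_eq_one (mon (-e)) (by rw [mon_mul_mon, add_neg_cancel, mon_zero])

theorem isUnit_var (n i : ℕ) : IsUnit (var n i) := isUnit_mon _

theorem evalMonomial_mon {S : Type*} [CommRing S] (a b : S)
    (g : Multiplicative (Fin n → ℤ) →* S) (e : Fin n → ℤ) :
    evalMonomial a b g (mon e) = g (Multiplicative.ofAdd e) := by
  rw [mon, evalMonomial_single, map_one, one_mul]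

theorem evalMonomial_param {S : Type*} [CommRing S] (a b : S)
    (g : Multiplicative (Fin n → ℤ) →* S) (i : Fin 2) :
    evalMonomial a b g (param n i) = ![a, b] i := by
  rw [param, evalMonomial_single, aeval_X, ofAdd_zero, map_one, mul_one]

theorem ringHom_ext_param_mon {S : Type*} [CommRing S]
    {f g : LaurentPoly (MvPolynomial (Fin 2) ℤ) n →+* S}
    (h0 : f (param n 0) = g (param n 0)) (h1 : f (param n 1) = g (param n 1))
    (hmon : ∀ e, f (mon e) = g (mon e)) : f = g := by
  refine AddMonoidAlgebra.ringHom_ext (fun r => ?_) hmon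
  have : f.comp AddMonoidAlgebra.singleZeroRingHom = g.comp AddMonoidAlgebra.singleZeroRingHom := by
    refine MvPolynomial.ringHom_ext' (Subsingleton.elim _ _) fun i => ?_
    fin_cases i
    · exact h0
    · exact h1
  exact DFunLike.congr_fun this r

/-- Evaluation of Laurent polynomials at `α = a`, `β = b` and nonzero `x_i` in a field. -/
noncomputable def evalAt {K : Type*} [Field K] (a b : K) (x : Fin n → K) (hx : ∀ i, x i ≠ 0) :
    LaurentPoly (MvPolynomial (Fin 2) ℤ) n →+* K :=
  evalMonomial a b
    { toFun := fun e => ∏ i, x i ^ e.toAdd i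
      map_one' := by simp
      map_mul' := fun e f => by
        rw [← Finset.prod_mul_distrib]
        exact Finset.prod_congr rfl fun i _ => zpow_add₀ (hx i) _ _ }

theorem evalAt_param {K : Type*} [Field K] (a b : K) (x : Fin n → K) (hx : ∀ i, x i ≠ 0)
    (i : Fin 2) : evalAt a b x hx (param n i) = ![a, b] i :=
  evalMonomial_param _ _ _ _

theorem evalAt_var {K : Type*} [Field K] (a b : K) (x : Fin n → K) (hx : ∀ i, x i ≠ 0)
    (i : Fin n) : evalAt a b x hx (var n i) = x i := by
  rw [evalAt, var, evalMonomial_mon]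
  change ∏ j, x j ^ (if (j : ℕ) = i then (1 : ℤ) else 0) = x i
  rw [Finset.prod_eq_single i]
  · simp
  · intro j _ hj
    rw [if_neg fun h => hj (Fin.ext h), zpow_zero]
  · simp

theorem evalAt_eq_value {K : Type*} [Field K] (a b : K) (x : Fin n → K) (hx : ∀ i, x i ≠ 0)
    (L : LaurentPoly (MvPolynomial (Fin 2) ℤ) n) : evalAt a b x hx L = L.value a b x := by
  conv_lhs => rw [← AddMonoidAlgebra.sum_coeff_single L]
  rw [Finsupp.sum, map_sum, value]
  exact Finset.sum_congr rfl fun e _ => evalMonomial_single _ _ _ _ _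

/-- Used with `denominatorSubring` as `T`, to bound the denominators of a shifted expression. -/
theorem value_mem {K : Type*} [Field K] (T : Subring K) {a b : K} {x : Fin n → K} (ha : a ∈ T)
    (hb : b ∈ T) (hx : ∀ i, x i ∈ T) (hx' : ∀ i, (x i)⁻¹ ∈ T)
    (L : LaurentPoly (MvPolynomial (Fin 2) ℤ) n) : L.value a b x ∈ T := by
  refine sum_mem fun e _ => mul_mem ?_ (prod_mem fun i _ => ?_)
  · generalize L.coeff e = r
    induction r using MvPolynomial.induction_on with
    | C c => simp
    | add r s hr hs => rw [map_add]; exact add_mem hr hs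
    | mul_X r i hr =>
      rw [map_mul, aeval_X]
      refine mul_mem hr ?_
      fin_cases i
      · exact ha
      · exact hb
  · obtain ⟨k, hk | hk⟩ := (e i).eq_nat_or_neg
    · rw [hk, zpow_natCast]
      exact pow_mem (hx i) k
    · rw [hk, zpow_neg, zpow_natCast, ← inv_pow]
      exact pow_mem (hx' i) k

/-- The element is linear in α with unit coefficient, so the quotient by it eliminates α and embeds
in the Laurent ring, a domain. -/
theorem prime_param_mul_mon_add (e f : Fin n → ℤ) :
    Prime (param n 0 * mon e + param n 1 * mon f) := by
  set u := param n 0 * mon e + param n 1 * mon f with hu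
  -- Substitute the root α = -β x^{f-e}. This is the identity modulo `u`, so the kernel is exactly
  -- the ideal of `u`.
  let φ : LaurentPoly (MvPolynomial (Fin 2) ℤ) n →+* LaurentPoly (MvPolynomial (Fin 2) ℤ) n :=
    evalMonomial (-(param n 1 * mon (f - e))) (param n 1) (AddMonoidAlgebra.of _ _)
  have φ0 : φ (param n 0) = -(param n 1 * mon (f - e)) := evalMonomial_param _ _ _ _
  have φ1 : φ (param n 1) = param n 1 := evalMonomial_param _ _ _ _
  have φmon (d : Fin n → ℤ) : φ (mon d) = mon d := evalMonomial_mon _ _ _ _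
  have φu : φ u = 0 := by
    rw [hu, map_add, map_mul, map_mul, φ0, φ1, φmon, φmon, neg_mul, mul_assoc, mon_mul_mon,
      sub_add_cancel, neg_add_cancel]
  have mk_comp : (Ideal.Quotient.mk (Ideal.span {u})).comp φ = Ideal.Quotient.mk _ := by
    refine ringHom_ext_param_mon ?_ ?_ fun d => ?_
    · rw [RingHom.comp_apply, φ0, Ideal.Quotient.eq, Ideal.mem_span_singleton]
      refine ⟨-mon (-e), ?_⟩
      have he : mon e * mon (-e) = 1 := by rw [mon_mul_mon, add_neg_cancel, mon_zero]
      rw [hu, sub_eq_add_neg f e, ← mon_mul_mon]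
      linear_combination param n 0 * he
    · rw [RingHom.comp_apply, φ1]
    · rw [RingHom.comp_apply, φmon]
  have dvd_iff (L) : u ∣ L ↔ φ L = 0 := by
    constructor
    · rintro ⟨M, rfl⟩
      rw [map_mul, φu, zero_mul]
    · intro h
      have := DFunLike.congr_fun mk_comp L
      rw [RingHom.comp_apply, h, map_zero] at this
      rw [← Ideal.mem_span_singleton, ← Ideal.Quotient.eq_zero_iff_mem, ← this]
  refine ⟨fun h => ?_, fun h => ?_, fun L M h => ?_⟩
  · have := congrArg (evalMonomial (1 : ℤ) 1 1) h
    rw [hu, map_add, map_mul, map_mul, evalMonomial_param, evalMonomial_param, evalMonomial_mon,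
      evalMonomial_mon, map_zero] at this
    simp at this
  · have := h.map φ
    rw [φu] at this
    exact not_isUnit_zero this
  · simpa only [dvd_iff, map_mul, mul_eq_zero] using h

end LaurentPoly

/-! ### Nonvanishing, existence and shifts of Gale-Robinson sequences. -/

/-- If `D` is a domain with fraction field `F` and `θ : D → ℤ` is a ring homomorphism, then the
terms of a Gale-Robinson sequence in `F` are nonzero as soon as the parameters and the initial terms
come from elements of `D` at which `θ` is positive. -/
theorem IsTwoTermGaleRobinson.ne_zero_of_pos {D F : Type*} [CommRing D] [Field F]
    [Algebra D F] [FaithfulSMul D F] (θ : D →+* ℤ) {n p q : ℕ} (hp : 0 < p) (hpq : p < q)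
    (hqn : 2 * q ≤ n) {A B : D} {X : ℕ → D} (hA : 0 < θ A) (hB : 0 < θ B)
    (hX : ∀ i < n, 0 < θ (X i)) {y : ℕ → F} (hy : ∀ i < n, y i = algebraMap D F (X i))
    (hrec : IsTwoTermGaleRobinson n p q (algebraMap D F A) (algebraMap D F B) y) (m : ℕ) :
    y m ≠ 0 := by
  have inj := FaithfulSMul.algebraMap_injective D F
  have ne_of_pos {d : D} (hd : 0 < θ d) : algebraMap D F d ≠ 0 := by
    rw [Ne, map_eq_zero_iff _ inj]
    rintro rfl
    simp at hd
  -- The recurrence is subtraction-free, so positivity of numerator and denominator under `θ`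
  -- propagates.
  suffices h : ∃ a b : D, 0 < θ a ∧ 0 < θ b ∧ y m = algebraMap D F a / algebraMap D F b by
    obtain ⟨a, b, ha, hb, h⟩ := h
    rw [h]
    exact div_ne_zero (ne_of_pos ha) (ne_of_pos hb)
  induction m using Nat.strong_induction_on with
  | _ m ih =>
    rcases lt_or_ge m n with hm | hm
    · exact ⟨X m, 1, hX m hm, by simp, by simp [hy m hm]⟩
    · obtain ⟨k, rfl⟩ := Nat.exists_eq_add_of_le' hm
      obtain ⟨a₀, b₀, ha₀, hb₀, h₀⟩ := ih k (by omega)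
      obtain ⟨a₁, b₁, ha₁, hb₁, h₁⟩ := ih (k + p) (by omega)
      obtain ⟨a₂, b₂, ha₂, hb₂, h₂⟩ := ih (k + n - p) (by omega)
      obtain ⟨a₃, b₃, ha₃, hb₃, h₃⟩ := ih (k + q) (by omega)
      obtain ⟨a₄, b₄, ha₄, hb₄, h₄⟩ := ih (k + n - q) (by omega)
      refine ⟨(A * a₁ * a₂ * (b₃ * b₄) + B * a₃ * a₄ * (b₁ * b₂)) * b₀, b₁ * b₂ * (b₃ * b₄) * a₀,
        ?_, ?_, ?_⟩
      · simp only [map_mul, map_add]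
        positivity
      · simp only [map_mul]
        positivity
      · rw [hrec k, h₀, h₁, h₂, h₃, h₄]
        have := ne_of_pos ha₀
        have := ne_of_pos hb₀
        have := ne_of_pos hb₁
        have := ne_of_pos hb₂
        have := ne_of_pos hb₃
        have := ne_of_pos hb₄
        simp only [map_mul, map_add]
        field_simp

/-- The Gale-Robinson sequence with initial terms `x_0, …, x_{n-1}`; the value `0` for inadmissible
`p` and `q` is never used. -/
noncomputable def galeRobinsonSeq {K : Type*} [Field K] (n p q : ℕ) (a b : K) (x : ℕ → K) :
    ℕ → K
  | m =>
    if m < n then x m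
    else if _h : n ≤ m ∧ 0 < p ∧ p < q ∧ 2 * q ≤ n then
      (a * galeRobinsonSeq n p q a b x (m - n + p) * galeRobinsonSeq n p q a b x (m - p) +
        b * galeRobinsonSeq n p q a b x (m - n + q) * galeRobinsonSeq n p q a b x (m - q)) /
        galeRobinsonSeq n p q a b x (m - n)
    else 0
termination_by m => m
decreasing_by all_goals omega

theorem galeRobinsonSeq_of_lt {K : Type*} [Field K] (n p q : ℕ) (a b : K) (x : ℕ → K) {m : ℕ}
    (hm : m < n) : galeRobinsonSeq n p q a b x m = x m := by
  rw [galeRobinsonSeq, if_pos hm]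

theorem isTwoTermGaleRobinson_galeRobinsonSeq {K : Type*} [Field K] {n p q : ℕ} (hp : 0 < p)
    (hpq : p < q) (hqn : 2 * q ≤ n) (a b : K) (x : ℕ → K) :
    IsTwoTermGaleRobinson n p q a b (galeRobinsonSeq n p q a b x) := by
  intro k
  rw [galeRobinsonSeq, if_neg (by omega), dif_pos (by omega), Nat.add_sub_cancel]

theorem IsTwoTermGaleRobinson.shift {K : Type*} [Field K] {n p q : ℕ} {a b : K} {y : ℕ → K}
    (h : IsTwoTermGaleRobinson n p q a b y) (hpn : p ≤ n) (hqn : q ≤ n) (s : ℕ) :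
    IsTwoTermGaleRobinson n p q a b (fun k => y (s + k)) := by
  intro k
  have e₁ : s + (k + n) = s + k + n := by omega
  have e₂ : s + (k + p) = s + k + p := by omega
  have e₃ : s + (k + n - p) = s + k + n - p := by omega
  have e₄ : s + (k + q) = s + k + q := by omega
  have e₅ : s + (k + n - q) = s + k + n - q := by omega
  simp only [e₁, e₂, e₃, e₄, e₅]
  exact h (s + k)

/-! ### Rings of fractions with restricted denominators. -/

/-- The elements of `F` with a denominator in the submonoid `M` of `D`. -/
def denominatorSubring {D : Type*} [CommRing D] (F : Type*) [Field F] [Algebra D F]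
    (M : Submonoid D) : Subring F where
  carrier := {f | ∃ s ∈ M, ∃ d, algebraMap D F s * f = algebraMap D F d}
  one_mem' := ⟨1, M.one_mem, 1, by simp⟩
  zero_mem' := ⟨1, M.one_mem, 0, by simp⟩
  mul_mem' := by
    rintro f g ⟨s, hs, d, h⟩ ⟨t, ht, e, h'⟩
    refine ⟨s * t, M.mul_mem hs ht, d * e, ?_⟩
    rw [map_mul, map_mul, ← h, ← h']
    ring
  add_mem' := by
    rintro f g ⟨s, hs, d, h⟩ ⟨t, ht, e, h'⟩
    refine ⟨s * t, M.mul_mem hs ht, t * d + s * e, ?_⟩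
    rw [map_mul, map_add, map_mul, map_mul, ← h, ← h']
    ring
  neg_mem' := by
    rintro f ⟨s, hs, d, h⟩
    exact ⟨s, hs, -d, by rw [map_neg, ← h, mul_neg]⟩

section denominatorSubring

variable {D F : Type*} [CommRing D] [Field F] [Algebra D F] {M : Submonoid D}

theorem algebraMap_mem_denominatorSubring (d : D) :
    algebraMap D F d ∈ denominatorSubring F M :=
  ⟨1, M.one_mem, d, by simp⟩

theorem inv_algebraMap_mem_denominatorSubring [FaithfulSMul D F] [Nontrivial D] {d : D}
    (hd : d ∈ M) (hd0 : d ≠ 0) : (algebraMap D F d)⁻¹ ∈ denominatorSubring F M := by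
  refine ⟨d, hd, 1, ?_⟩
  rw [mul_inv_cancel₀, map_one]
  rwa [Ne, map_eq_zero_iff _ (FaithfulSMul.algebraMap_injective D F)]

theorem inv_algebraMap_mem_denominatorSubring_of_isUnit {d : D} (hd : IsUnit d) :
    (algebraMap D F d)⁻¹ ∈ denominatorSubring F M := by
  obtain ⟨e, he⟩ := hd.exists_right_inv
  have : algebraMap D F d * algebraMap D F e = 1 := by rw [← map_mul, he, map_one]
  rw [inv_eq_of_mul_eq_one_right this]
  exact algebraMap_mem_denominatorSubring e

/-- If π^k f = d and s f = e, then s d = π^k e; as the prime π does not divide s, π^k divides d. -/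
theorem exists_algebraMap_eq_of_mem_denominatorSubring [IsDomain D] [FaithfulSMul D F] {π : D}
    (hπ : Prime π) (hM : ∀ s ∈ M, ¬π ∣ s) {f : F}
    (h₁ : f ∈ denominatorSubring F (Submonoid.powers π)) (h₂ : f ∈ denominatorSubring F M) :
    ∃ d, algebraMap D F d = f := by
  have inj := FaithfulSMul.algebraMap_injective D F
  obtain ⟨_, ⟨k, rfl⟩, d, hd⟩ := h₁
  obtain ⟨s, hs, e, he⟩ := h₂
  have h : π ^ k ∣ s * d := by
    refine ⟨e, inj ?_⟩
    rw [map_mul, map_mul, ← hd, ← he]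
    ring
  obtain ⟨c, rfl⟩ := hπ.pow_dvd_of_dvd_mul_left k (hM s hs) h
  refine ⟨c, ?_⟩
  rw [map_mul] at hd
  refine (mul_left_cancel₀ ?_ hd).symm
  rw [Ne, map_eq_zero_iff _ inj]
  exact pow_ne_zero k hπ.ne_zero

end denominatorSubring

/-! ### Specialization to arbitrary fields. -/

namespace LaurentPoly

variable {n p q m : ℕ}

/-- Laurent polynomials that satisfy the recurrence express the terms of every Gale-Robinson
sequence through its initial terms. -/
theorem apply_eq_value (hp : 0 < p) (hpq : p < q) (hqn : 2 * q ≤ n)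
    {L : ℕ → LaurentPoly (MvPolynomial (Fin 2) ℤ) n} (hL : ∀ i < m, i < n → L i = var n i)
    (hrec : SatisfiesGaleRobinsonBelow n p q m (param n 0) (param n 1) L)
    {K : Type*} [Field K] {a b : K} {z : ℕ → K} (hz : ∀ k, z k ≠ 0)
    (hzrec : IsTwoTermGaleRobinson n p q a b z) {i : ℕ} (hi : i < m) :
    z i = (L i).value a b fun j => z j := by
  have hx (j : Fin n) : z j ≠ 0 := hz j
  rw [← evalAt_eq_value a b _ hx]
  set ψ := evalAt a b (fun j : Fin n => z j) hx with hψ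
  induction i using Nat.strong_induction_on with
  | _ i ih =>
    rcases lt_or_ge i n with hin | hin
    · rw [hL i hi hin]
      exact (evalAt_var a b _ hx ⟨i, hin⟩).symm
    · obtain ⟨k, rfl⟩ := Nat.exists_eq_add_of_le' hin
      have h := hrec.map ψ k hi
      dsimp only at h
      rw [← ih k (by omega) (by omega), ← ih (k + p) (by omega) (by omega),
        ← ih (k + n - p) (by omega) (by omega), ← ih (k + q) (by omega) (by omega),
        ← ih (k + n - q) (by omega) (by omega), hψ, evalAt_param, evalAt_param] at h
      rw [hzrec k, div_eq_iff (hz k), h]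
      rfl

end LaurentPoly

/-! ### The induction proving the Laurent phenomenon. -/

section LaurentPhenomenon

open LaurentPoly

variable {n p q m : ℕ} {F : Type*} [Field F]
  [Algebra (LaurentPoly (MvPolynomial (Fin 2) ℤ) n) F]
  [FaithfulSMul (LaurentPoly (MvPolynomial (Fin 2) ℤ) n) F]

/-- The evaluation at `α = 1`, `β = 2`, `x_p = -2`, and `x_i = 1` for `i ≠ p`. -/
theorem exists_parity_specialization (n p : ℕ) :
    ∃ ψ : LaurentPoly (MvPolynomial (Fin 2) ℤ) n →+* ℚ, ψ (param n 0) = 1 ∧ ψ (param n 1) = 2 ∧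
      ∀ i < n, ψ (var n i) = if i = p then -2 else 1 := by
  have hx (i : Fin n) : (if (i : ℕ) = p then -2 else 1 : ℚ) ≠ 0 := by split_ifs <;> norm_num
  exact ⟨evalAt 1 2 _ hx, evalAt_param _ _ _ _ _, evalAt_param _ _ _ _ _,
    fun i hi => evalAt_var _ _ _ hx ⟨i, hi⟩⟩

theorem SatisfiesGaleRobinsonBelow.of_algebraMap
    {L : ℕ → LaurentPoly (MvPolynomial (Fin 2) ℤ) n} {y : ℕ → F} (hp : 0 < p) (hpq : p < q)
    (hqn : 2 * q ≤ n) (hy : ∀ k, y k ≠ 0)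
    (hrec : IsTwoTermGaleRobinson n p q (algebraMap _ F (param n 0)) (algebraMap _ F (param n 1)) y)
    (hL : ∀ i < m, algebraMap _ F (L i) = y i) :
    SatisfiesGaleRobinsonBelow n p q m (param n 0) (param n 1) L := by
  intro k hk
  apply FaithfulSMul.algebraMap_injective _ F
  simp only [map_mul, map_add]
  rw [hL _ hk, hL k (by omega), hL (k + p) (by omega), hL (k + n - p) (by omega),
    hL (k + q) (by omega), hL (k + n - q) (by omega), hrec k, div_mul_cancel₀ _ (hy k)]

/-- Up to the unit x_0, this is α and β times two monomials, added. -/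
theorem SatisfiesGaleRobinsonBelow.prime_apply
    {L : ℕ → LaurentPoly (MvPolynomial (Fin 2) ℤ) n} (hp : 0 < p) (hpq : p < q)
    (hqn : 2 * q ≤ n) (hL : ∀ i < n, L i = var n i) (hm : n < m)
    (hrec : SatisfiesGaleRobinsonBelow n p q m (param n 0) (param n 1) L) : Prime (L n) := by
  have h : L n * L 0 = param n 0 * L p * L (n - p) + param n 1 * L q * L (n - q) := by
    apply hrec.rel <;> omega
  rw [hL 0 (by omega), hL p (by omega), hL (n - p) (by omega), hL q (by omega),
    hL (n - q) (by omega), mul_assoc, mul_assoc] at h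
  have hu : Associated (L n) (L n * var n 0) :=
    (associated_mul_unit_right _ _ (isUnit_var n 0))
  rw [hu.prime_iff, h]
  simp only [var, mon_mul_mon]
  exact prime_param_mul_mon_add _ _

/-- `y (2 * n)` stays in `F`, so that this can show it to be a Laurent polynomial: its multiplier is
a unit. -/
theorem SatisfiesGaleRobinsonBelow.cofactor_eq
    {L : ℕ → LaurentPoly (MvPolynomial (Fin 2) ℤ) n} {y : ℕ → F} (hp : 0 < p) (hpq : p < q)
    (hqn : 2 * q ≤ n) (hy : ∀ k, y k ≠ 0)
    (hrec : IsTwoTermGaleRobinson n p q (algebraMap _ F (param n 0)) (algebraMap _ F (param n 1)) y)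
    (hL : ∀ i < 2 * n, algebraMap _ F (L i) = y i) :
    algebraMap _ F (cofactor n p q (param n 0) (param n 1) L) =
      y (2 * n) * algebraMap _ F (L p * L (n - p) * (L q * L (n - q))) := by
  have h := congrArg (algebraMap _ F)
    ((SatisfiesGaleRobinsonBelow.of_algebraMap hp hpq hqn hy hrec hL).numerator_mul_eq
      le_rfl hp hpq hqn)
  have h2 := hrec n
  rw [← two_mul, eq_div_iff (hy n)] at h2
  rw [map_mul, map_mul _ (L n), hL n (by omega)] at h
  refine mul_left_cancel₀ (hy n) (h.symm.trans ?_)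
  rw [← mul_assoc (y n), mul_comm (y n), h2]
  simp only [map_add, map_mul]
  rw [hL (n + p) (by omega), hL (2 * n - p) (by omega), hL (n + q) (by omega),
    hL (2 * n - q) (by omega)]

theorem exists_algebraMap_eq_galeRobinson (hp : 0 < p) (hpq : p < q) (hqn : 2 * q ≤ n)
    {y : ℕ → F} (hy : ∀ k, y k ≠ 0) (hinit : ∀ i < n, y i = algebraMap _ F (var n i))
    (hrec : IsTwoTermGaleRobinson n p q (algebraMap _ F (param n 0)) (algebraMap _ F (param n 1)) y)
    (m : ℕ) : ∃ L, algebraMap (LaurentPoly (MvPolynomial (Fin 2) ℤ) n) F L = y m := by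
  have inj := FaithfulSMul.algebraMap_injective (LaurentPoly (MvPolynomial (Fin 2) ℤ) n) F
  induction m using Nat.strong_induction_on with
  | _ m ih =>
  choose! L hL using ih
  have hLinit (i : ℕ) (him : i < m) (hin : i < n) : L i = var n i :=
    inj ((hL i him).trans (hinit i hin))
  have hLrec := SatisfiesGaleRobinsonBelow.of_algebraMap hp hpq hqn hy hrec hL
  rcases lt_or_ge m n with hmn | hmn
  · exact ⟨var n m, (hinit m hmn).symm⟩
  rcases lt_or_ge m (2 * n) with hm2 | hm2
  · obtain ⟨k, rfl⟩ := Nat.exists_eq_add_of_le' hmn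
    obtain ⟨c, hc⟩ := (isUnit_var n k).exists_right_inv
    refine ⟨(param n 0 * L (k + p) * L (k + n - p) + param n 1 * L (k + q) * L (k + n - q)) * c,
      ?_⟩
    rw [hrec k, eq_div_iff (hy k), hinit k (by omega), ← map_mul, mul_assoc, mul_comm c, hc,
      mul_one]
    simp only [map_add, map_mul]
    rw [hL (k + p) (by omega), hL (k + n - p) (by omega), hL (k + q) (by omega),
      hL (k + n - q) (by omega)]
  have hLinit' (i : ℕ) (hin : i < n) : L i = var n i := hLinit i (by omega) hin
  have hcof := SatisfiesGaleRobinsonBelow.cofactor_eq hp hpq hqn hy hrec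
    (fun i hi => hL i (hi.trans_le hm2))
  rcases hm2.eq_or_lt with rfl | hm2
  · have hunit : IsUnit (L p * L (n - p) * (L q * L (n - q))) := by
      rw [hLinit' p (by omega), hLinit' (n - p) (by omega), hLinit' q (by omega),
        hLinit' (n - q) (by omega)]
      exact ((isUnit_var n _).mul (isUnit_var n _)).mul ((isUnit_var n _).mul (isUnit_var n _))
    obtain ⟨c, hc⟩ := hunit.exists_right_inv
    refine ⟨SatisfiesGaleRobinsonBelow.cofactor n p q (param n 0) (param n 1) L * c, ?_⟩
    rw [map_mul, hcof, mul_assoc, ← map_mul, hc, map_one, mul_one]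
  have hprime := hLrec.prime_apply hp hpq hqn hLinit' (by omega)
  -- A multiple of `L n` would vanish under the parity specialization.
  have hndvd (j : ℕ) (hj : j < n) : ¬L n ∣ L (n + 1 + j) := by
    obtain ⟨ψ, ψ0, ψ1, ψvar⟩ := exists_parity_specialization n p
    have hv := hLrec.map ψ
    have hvinit : ∀ i < n, ψ (L i) = if i = p then -2 else 1 := fun i hi => by
      rw [hLinit' i hi, ψvar i hi]
    rw [ψ0, ψ1] at hv
    have hvn := hv.apply_n_eq_zero (by omega) hp hpq hqn hvinit
    rintro ⟨c, hc⟩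
    have hvj : ψ (L (n + 1 + j)) = 0 := by rw [hc, map_mul, hvn, zero_mul]
    rcases (by omega : n + 1 + j < 2 * n ∨ n + 1 + j = 2 * n) with hj2 | hj2
    · exact hv.apply_ne_zero (by omega) hp hpq hqn hvinit _ (by omega) hj2 hvj
    · apply hv.cofactor_ne_zero (by omega) hp hpq hqn hvinit
      rw [hj2] at hvj
      have hcof' : SatisfiesGaleRobinsonBelow.cofactor n p q (param n 0) (param n 1) L =
          L (2 * n) * (L p * L (n - p) * (L q * L (n - q))) := inj (by
        rw [hcof, map_mul _ (L (2 * n)), hL (2 * n) hm2])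
      have := congrArg ψ hcof'
      rw [map_mul, hvj, zero_mul] at this
      rw [← this]
      simp only [SatisfiesGaleRobinsonBelow.cofactor, map_add, map_mul, map_pow, ψ0, ψ1]
  -- `y m` is term m - s of the sequence started at s, and m - s < m, so the induction hypothesis
  -- supplies its Laurent expression.
  have value_shift (s : ℕ) (hs : 0 < s) (hsm : s ≤ m) :
      y m = (L (m - s)).value (algebraMap _ F (param n 0)) (algebraMap _ F (param n 1))
        fun j => y (s + j) := by
    have := apply_eq_value hp hpq hqn hLinit hLrec (fun k => hy (s + k))
      (hrec.shift (by omega) (by omega) s) (i := m - s) (by omega)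
    rwa [Nat.add_sub_cancel' hsm] at this
  let M : Submonoid (LaurentPoly (MvPolynomial (Fin 2) ℤ) n) :=
    { carrier := {s | ¬L n ∣ s}
      one_mem' := hprime.not_dvd_one
      mul_mem' := fun hs ht h => (hprime.dvd_or_dvd h).elim hs ht }
  refine exists_algebraMap_eq_of_mem_denominatorSubring hprime (M := M) (fun s hs => hs) ?_ ?_
  -- Window 1, …, n: all terms but the last are units.
  · rw [value_shift 1 one_pos (by omega)]
    refine value_mem _ (algebraMap_mem_denominatorSubring _) (algebraMap_mem_denominatorSubring _)
      (fun j => ?_) (fun j => ?_) _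
    · rw [← hL _ (by omega)]
      exact algebraMap_mem_denominatorSubring _
    · rw [← hL _ (by omega)]
      rcases (by omega : 1 + (j : ℕ) < n ∨ 1 + (j : ℕ) = n) with hj | hj
      · rw [hLinit' _ hj]
        exact inv_algebraMap_mem_denominatorSubring_of_isUnit (isUnit_var n _)
      · rw [hj]
        exact inv_algebraMap_mem_denominatorSubring (Submonoid.mem_powers _) hprime.ne_zero
  -- Window n+1, …, 2n: no term is divisible by `L n`.
  · rw [value_shift (n + 1) (by omega) (by omega)]
    refine value_mem _ (algebraMap_mem_denominatorSubring _) (algebraMap_mem_denominatorSubring _)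
      (fun j => ?_) (fun j => ?_) _
    · rw [← hL _ (by omega)]
      exact algebraMap_mem_denominatorSubring _
    · rw [← hL _ (by omega)]
      exact inv_algebraMap_mem_denominatorSubring (hndvd j j.2)
        (fun h => hndvd j j.2 (h ▸ dvd_zero _))

end LaurentPhenomenon

theorem theorem1p4 (n p q : ℕ) (hp : 0 < p) (hpq : p < q) (hqn : 2 * q ≤ n)
    (y : ℕ → RatFunField n) (hinit : ∀ i : Fin n, y i = RatFunField.x i)
    (hrec : IsTwoTermGaleRobinson n p q (RatFunField.α n) (RatFunField.β n) y) (m : ℕ) :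
    y m ≠ 0 ∧
    ∃ L : LaurentPoly (MvPolynomial (Fin 2) ℤ) n,
      y m = L.value (RatFunField.α n) (RatFunField.β n) (fun i => RatFunField.x i) ∧
      ∀ (K : Type u) [Field K] (a b : K) (z : ℕ → K), (∀ k, z k ≠ 0) →
        IsTwoTermGaleRobinson n p q a b z → z m = L.value a b (fun i => z i) := by
  have hy : ∀ k, y k ≠ 0 := fun k =>
    IsTwoTermGaleRobinson.ne_zero_of_pos (D := MvPolynomial (Fin 2 ⊕ Fin n) ℤ)
      (MvPolynomial.eval fun _ => 1) hp hpq hqn (A := MvPolynomial.X (Sum.inl 0))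
      (B := MvPolynomial.X (Sum.inl 1))
      (X := fun i => if h : i < n then MvPolynomial.X (Sum.inr ⟨i, h⟩) else 1)
      (by simp) (by simp) (fun i hi => by simp [hi])
      (fun i hi => by rw [dif_pos hi]; exact hinit ⟨i, hi⟩) hrec k
  refine ⟨hy m, ?_⟩
  let Λ := LaurentPoly (MvPolynomial (Fin 2) ℤ) n
  let α := algebraMap Λ (FractionRing Λ) (LaurentPoly.param n 0)
  let β := algebraMap Λ (FractionRing Λ) (LaurentPoly.param n 1)
  let x (i : ℕ) := algebraMap Λ (FractionRing Λ) (LaurentPoly.var n i)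
  -- The induction runs on a copy of the sequence in the fraction field of Λ; the given `y` is then
  -- treated as one more specialization.
  let w := galeRobinsonSeq n p q α β x
  have hwrec : IsTwoTermGaleRobinson n p q α β w :=
    isTwoTermGaleRobinson_galeRobinsonSeq hp hpq hqn α β x
  have hwinit (i : ℕ) (hi : i < n) : w i = x i := galeRobinsonSeq_of_lt n p q α β x hi
  have hparam (i : Fin 2) : 0 < LaurentPoly.evalMonomial (1 : ℤ) 1 1 (LaurentPoly.param n i) := by
    rw [LaurentPoly.evalMonomial_param]
    fin_cases i <;> exact one_pos
  have hvar (i : ℕ) : 0 < LaurentPoly.evalMonomial (1 : ℤ) 1 1 (LaurentPoly.var n i) := by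
    rw [LaurentPoly.var, LaurentPoly.evalMonomial_mon]
    exact one_pos
  have hw : ∀ k, w k ≠ 0 := fun k =>
    IsTwoTermGaleRobinson.ne_zero_of_pos (D := Λ) (LaurentPoly.evalMonomial 1 1 1) hp hpq hqn
      (hparam 0) (hparam 1) (fun i _ => hvar i) hwinit hwrec k
  choose L hL using exists_algebraMap_eq_galeRobinson hp hpq hqn hw hwinit hwrec
  have hLinit (i : ℕ) (_ : i < m + 1) (hi : i < n) : L i = LaurentPoly.var n i :=
    FaithfulSMul.algebraMap_injective Λ (FractionRing Λ) ((hL i).trans (hwinit i hi))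
  have hLrec : SatisfiesGaleRobinsonBelow n p q (m + 1) (LaurentPoly.param n 0)
      (LaurentPoly.param n 1) L :=
    SatisfiesGaleRobinsonBelow.of_algebraMap hp hpq hqn hw hwrec fun i _ => hL i
  refine ⟨L m, ?_, fun K _ a b z hz hzrec =>
    LaurentPoly.apply_eq_value hp hpq hqn hLinit hLrec hz hzrec m.lt_succ_self⟩
  rw [← funext hinit]
  exact LaurentPoly.apply_eq_value hp hpq hqn hLinit hLrec hy hrec m.lt_succ_self
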